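/- **Setting.** There are $n$ buyers in a first-price auction. Buyer $i$ has one of the values $0\le v_i^1<v_i^2<\dots<v_i^{d_i}$ ($d_i\ge 1$), each with positive probability; $G_i$ is the cumulative distribution function of his value, with the convention $G_i(v_i^0)=0$. (The distributions are encoded equivalently by $p_i^j=\ln G_i(v_i^j)-\ln G_i(v_i^{j-1})$, $j\ge 2$.) **The algorithm.** Given a guess $\bar b\ge 0$ of the largest winning bid, the algorithm moves a bid $b$ down from $\bar b$. It keeps a bidding set $\Lambda$ of buyers (the other buyers form the waiting list), for each buyer $i$ his largest unconsumed value $v_i$ (initially $v_i^{d_i}$), and the value $F_i(b)$ of his cumulative bid distribution (initially $1$). * *Entering.* A buyer $i$ of the waiting list satisfies the entry condition at the bid $x$ if $v_i>x$ and either $|\Lambda|\le 1$ or $\frac1{v_i-x}\le\frac1{|\Lambda|-1}\sum_{j\in\Lambda}\frac1{v_j-x}$. To add buyers at $b$ means: as long as a buyer with the largest unconsumed value in the waiting list satisfies the entry condition at $b$, he is put into $\Lambda$ and enters with his value $v_i$ at $b$ (ties are broken arbitrarily). * *Bidding.* While $\Lambda$ does not change, $F_i$ is constant for $i\notin\Lambda$,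 and $(\ln F_i)'(x)=\frac1{|\Lambda|-1}\sum_{j\in\Lambda}\frac1{v_j-x}-\frac1{v_i-x}$ for $i\in\Lambda$. * *Leaving.* A buyer $i\in\Lambda$ bidding with $v_i=v_i^k$ consumes this value and leaves $\Lambda$ at the bid $x$ if $F_i(x)=G_i(v_i^{k-1})$; his largest unconsumed value is then $v_i^{k-1}$. The algorithm starts with $b=\bar b$, $\Lambda=\emptyset$ and adds buyers at $\bar b$. While $|\Lambda|\ge 2$ and $b>0$, it determines the next change position $b'$, i.e. the largest $b'\in[0,b)$ at which some buyer of $\Lambda$ leaves or some buyer of the waiting list satisfies the entry condition (and $b'=0$ if there is no such positive bid), sets $b\leftarrow b'$, removes all buyers that leave at $b'$, and then adds buyers at $b'$. When it stops, it returns $\underline b(\bar b)=b$. The structure $\mathcal E(\bar b,\{p_i^j\})$ consists of the bid intervals $[\underline l_i^j(\bar b),\overline l_i^j(\bar b)]$, for all buyers $i$ and all $1\le j\le d_i$, where $\overline l_i^j(\bar b)$ is the bid at which buyer $i$ enters the bidding set with the value $v_i^j$ and $\underline l_i^j(\bar b)$ is the bid at which he leaves it with this value; an endpoint that has not been determined when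 the algorithm stops is set to $\underline b(\bar b)$. **Theorem.** For every $\bar b\ge 0$ the algorithm terminates. The endpoints of every bid interval are nondecreasing in $\bar b$: if $0\le\bar b_1\le\bar b_2$, then for every buyer $i$ and every $1\le j\le d_i$ $$\underline l_i^j(\bar b_1)\le\underline l_i^j(\bar b_2)\quad\text{and}\quad \overline l_i^j(\bar b_1)\le\overline l_i^j(\bar b_2),$$ however ties are broken in the two runs. -/

import Mathlib

namespace FirstPrice

/-- The value distributions of `n` buyers. Buyer `i` has value `v i j` with probability `q i j`,
`1 ≤ j ≤ d i`, and his values are nonnegative and listed in increasing order. Indices `j` outside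
`1, …, d i` carry no meaning. -/
structure ValueProfile (n : ℕ) where
  d : Fin n → ℕ
  d_pos : ∀ i, 1 ≤ d i
  v : Fin n → ℕ → ℝ
  v_nonneg : ∀ i, 0 ≤ v i 1
  v_lt : ∀ i j, 1 ≤ j → j < d i → v i j < v i (j + 1)
  q : Fin n → ℕ → ℝ
  q_pos : ∀ i j, 1 ≤ j → j ≤ d i → 0 < q i j
  q_sum : ∀ i, ∑ j ∈ Finset.Icc 1 (d i), q i j = 1

/-- The cumulative value distribution `G_i` at the value `v i j`; it is `0` for `j = 0`. -/
noncomputable def ValueProfile.G {n : ℕ} (D : ValueProfile n) (i : Fin n) (j : ℕ) : ℝ :=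
  ∑ l ∈ Finset.Icc 1 j, D.q i l

/-- A state of the backward-shooting algorithm. -/
structure State (n : ℕ) where
  /-- the current bid `b` -/
  b : ℝ
  /-- the bidding set `Λ(b)`; its complement is the waiting list -/
  bidders : Finset (Fin n)
  /-- the index of the largest unconsumed value of each buyer -/
  idx : Fin n → ℕ
  /-- the cumulative bid distribution `F_i(b)` of each buyer at the current bid -/
  F : Fin n → ℝ
  /-- the bid, if any so far, at which buyer `i` entered the bidding set with his `j`-th value -/
  enter : Fin n → ℕ → Option ℝ
  /-- the bid, if any so far, at which buyer `i` left the bidding set with his `j`-th value -/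
  leave : Fin n → ℕ → Option ℝ

variable {n : ℕ}

/-- The value with which buyer `i` bids, or waits to bid: his largest unconsumed value. -/
def State.val (D : ValueProfile n) (s : State n) (i : Fin n) : ℝ := D.v i (s.idx i)

/-- The condition under which buyer `i` of the waiting list enters the bidding set at the bid `x`. -/
def State.EntryCondition (D : ValueProfile n) (s : State n) (i : Fin n) (x : ℝ) : Prop :=
  x < s.val D i ∧
    (s.bidders.card ≤ 1 ∨
      1 / (s.val D i - x) ≤
        1 / ((s.bidders.card : ℝ) - 1) * ∑ j ∈ s.bidders, 1 / (s.val D j - x))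

/-- One buyer is added: a buyer with the largest unconsumed value in the waiting list enters
if he satisfies the entry condition at the current bid. Ties are broken arbitrarily. -/
def AddBuyer (D : ValueProfile n) (s t : State n) : Prop :=
  ∃ i, i ∉ s.bidders ∧ (∀ k, k ∉ s.bidders → s.val D k ≤ s.val D i) ∧
    s.EntryCondition D i s.b ∧
    t = { s with
      bidders := insert i s.bidders
      enter := Function.update s.enter i
        (Function.update (s.enter i) (s.idx i) (some s.b)) }

/-- Buyers are added repeatedly, until no more buyer enters. -/
def AddBuyers (D : ValueProfile n) (s t : State n) : Prop :=
  Relation.ReflTransGen (AddBuyer D) s t ∧ ∀ u, ¬ AddBuyer D t u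

/-- The antiderivative `H_i` of
`h_i(x) = (1 / (|Λ| - 1)) ∑_{j ∈ Λ} 1 / (v_j - x) - 1 / (v_i - x)` for the present bidding set. -/
noncomputable def State.H (D : ValueProfile n) (s : State n) (i : Fin n) (x : ℝ) : ℝ :=
  Real.log (s.val D i - x) -
    1 / ((s.bidders.card : ℝ) - 1) * ∑ j ∈ s.bidders, Real.log (s.val D j - x)

open Classical in
/-- The bid distribution `F_i(x)` at a bid `x ≤ b`, as long as the bidding set does not change:
`(ln F_i)' = h_i` for the buyers in the bidding set, while the others do not bid. -/
noncomputable def State.bidCdf (D : ValueProfile n) (s : State n) (i : Fin n) (x : ℝ) : ℝ :=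
  if i ∈ s.bidders then s.F i * Real.exp (s.H D i x - s.H D i s.b) else s.F i

/-- At the bid `x` buyer `i` has used up the probability of the value he is bidding with. -/
def State.Consumed (D : ValueProfile n) (s : State n) (i : Fin n) (x : ℝ) : Prop :=
  i ∈ s.bidders ∧ s.bidCdf D i x = D.G i (s.idx i - 1)

/-- `x` is the next change position: the largest bid below the current bid at which some buyer
leaves or enters. Bids are nonnegative, so it is `0` if there is no change at a positive bid. -/
def State.IsNextBid (D : ValueProfile n) (s : State n) (x : ℝ) : Prop :=
  IsGreatest {y : ℝ | 0 ≤ y ∧ y < s.b ∧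
    (y = 0 ∨ (∃ i, s.Consumed D i y) ∨ ∃ i, i ∉ s.bidders ∧ s.EntryCondition D i y)} x

open Classical in
/-- The bid moves down to `x`, and the buyers whose current value is consumed are removed from
the bidding set. -/
noncomputable def State.moveTo (D : ValueProfile n) (s : State n) (x : ℝ) : State n where
  b := x
  bidders := s.bidders.filter fun i => ¬ s.Consumed D i x
  idx := fun i => if s.Consumed D i x then s.idx i - 1 else s.idx i
  F := fun i => s.bidCdf D i x
  enter := s.enter
  leave := fun i j => if s.Consumed D i x ∧ j = s.idx i then some x else s.leave i j

/-- The loop condition `|Λ(b)| ≥ 2` and `b > 0`. -/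
def State.Running (s : State n) : Prop := 2 ≤ s.bidders.card ∧ 0 < s.b

/-- One pass through the loop. -/
def LoopStep (D : ValueProfile n) (s t : State n) : Prop :=
  s.Running ∧ ∃ x, s.IsNextBid D x ∧ AddBuyers D (s.moveTo D x) t

/-- The state before any buyer is added: the guessed largest winning bid and no bidders. -/
def initial (D : ValueProfile n) (bbar : ℝ) : State n where
  b := bbar
  bidders := ∅
  idx := D.d
  F := fun _ => 1
  enter := fun _ _ => none
  leave := fun _ _ => none

/-- The algorithm with the guess `bbar` terminates in the state `s`. -/
def IsOutput (D : ValueProfile n) (bbar : ℝ) (s : State n) : Prop :=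
  ∃ s₀, AddBuyers D (initial D bbar) s₀ ∧ Relation.ReflTransGen (LoopStep D) s₀ s ∧ ¬ s.Running

/-- The upper endpoint of the bid interval of buyer `i` with his `j`-th value, in a final state:
the bid at which he enters. A value that never enters is assigned to the final bid. -/
noncomputable def State.upper (s : State n) (i : Fin n) (j : ℕ) : ℝ := (s.enter i j).getD s.b

/-- The lower endpoint of the bid interval of buyer `i` with his `j`-th value, in a final state:
the bid at which he leaves, or the final bid if he does not leave before. -/
noncomputable def State.lower (s : State n) (i : Fin n) (j : ℕ) : ℝ := (s.leave i j).getD s.b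

end FirstPrice

namespace FirstPrice

variable {n : ℕ} {D : ValueProfile n} {s t u : State n} {i : Fin n} {x y : ℝ}

/-! ### Value distributions -/

/-! Both runs are followed down through the same bids. Where the lower guess starts, all its `F i`
equal `1`, so the run with the higher guess, if it gets that far, has smaller or equal `F`. This
order persists (`Ahead`). As `F i` lies in the half-open interval from `G i (k - 1)` to `G i k`,
with `k` the current index, smaller `F` forces smaller indices and hence smaller values.

Smaller values intensify bidding. Bidders have gap at most `1`, and gaps decrease with the bid and
with the other values, so a bidder of the first run whose current value is the same in the second
also bids there (`Ahead.mem_bidders`). Averages only grow when values drop (`State.rate_le_rate`),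
so on a common value the second `F` falls faster; distinct values are separated by a level of `G`
(`Ahead.bidCdf_le`). Thus each entry or departure in the first run has already been matched in the
second. Change positions of the runs differ, so moves are cut at quiet intermediate bids
(`Move.interrupt`).

Termination: next change positions exist by compactness, and an integer potential drops at each
change. -/

theorem ValueProfile.v_mono (D : ValueProfile n) (i : Fin n) {j k : ℕ} (hj : 1 ≤ j) (hjk : j ≤ k)
    (hk : k ≤ D.d i) : D.v i j ≤ D.v i k := by
  induction k, hjk using Nat.le_induction with
  | base => exact le_rfl
  | succ k hjk ih => exact (ih (by omega)).trans (D.v_lt i k (by omega) (by omega)).le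

theorem ValueProfile.G_zero (D : ValueProfile n) (i : Fin n) : D.G i 0 = 0 := by
  simp [ValueProfile.G]

theorem ValueProfile.G_succ (D : ValueProfile n) (i : Fin n) (j : ℕ) :
    D.G i (j + 1) = D.G i j + D.q i (j + 1) :=
  Finset.sum_Icc_succ_top (by omega) _

theorem ValueProfile.G_d (D : ValueProfile n) (i : Fin n) : D.G i (D.d i) = 1 := D.q_sum i

theorem ValueProfile.G_pred_lt (D : ValueProfile n) (i : Fin n) {j : ℕ} (hj : 1 ≤ j)
    (hd : j ≤ D.d i) : D.G i (j - 1) < D.G i j := by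
  obtain ⟨k, rfl⟩ : ∃ k, j = k + 1 := ⟨j - 1, by omega⟩
  have := D.q_pos i (k + 1) hj hd
  rw [D.G_succ]
  simpa using this

theorem ValueProfile.G_mono (D : ValueProfile n) (i : Fin n) {j k : ℕ} (hjk : j ≤ k)
    (hk : k ≤ D.d i) : D.G i j ≤ D.G i k := by
  induction k, hjk using Nat.le_induction with
  | base => exact le_rfl
  | succ k hjk ih => exact (ih (by omega)).trans (D.G_pred_lt i (by omega) hk).le

/-! ### The bidding set -/

/-- A buyer with a value above `x` belongs to the bidding set at `x` if and only if his gap is at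
most `1`. -/
noncomputable def State.gap (D : ValueProfile n) (s : State n) (i : Fin n) (x : ℝ) : ℝ :=
  ∑ j, max (s.val D j - s.val D i) 0 / (s.val D j - x)

/-- The average `(1 / (|Λ| - 1)) ∑_{j ∈ Λ} 1 / (v_j - x)`. -/
noncomputable def State.rate (D : ValueProfile n) (s : State n) (x : ℝ) : ℝ :=
  1 / ((s.bidders.card : ℝ) - 1) * ∑ j ∈ s.bidders, 1 / (s.val D j - x)

theorem gap_term_nonneg {a v x : ℝ} (hx : x < a) : 0 ≤ max (v - a) 0 / (v - x) := by
  rcases le_total v a with h | h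
  · simp [max_eq_right (sub_nonpos.2 h)]
  · exact div_nonneg (le_max_right _ _) (by linarith)

theorem gap_term_mono {a v w x y : ℝ} (hxy : x ≤ y) (hy : y < a) (hvw : v ≤ w) :
    max (v - a) 0 / (v - x) ≤ max (w - a) 0 / (w - y) := by
  rcases le_total v a with h | h
  · rw [max_eq_right (sub_nonpos.2 h), zero_div]
    exact gap_term_nonneg hy
  · rw [max_eq_left (by linarith), max_eq_left (by linarith),
      div_le_div_iff₀ (by linarith) (by linarith)]
    nlinarith [mul_nonneg (sub_nonneg.2 hvw) (sub_nonneg.2 hy.le),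
      mul_nonneg (sub_nonneg.2 (h.trans hvw)) (sub_nonneg.2 hxy)]

/-- For `v ≥ a`, `(v - a) / (v - x) = 1 - (a - x) / (v - x)` increases in both `v` and `x`. Hence
membership in the bidding set survives a lower bid and lower rival values, as long as the own value
is kept. -/
theorem State.gap_mono (hi : s.val D i = t.val D i) (hv : ∀ j, s.val D j ≤ t.val D j)
    (hxy : x ≤ y) (hy : y < t.val D i) : s.gap D i x ≤ t.gap D i y := by
  unfold State.gap
  rw [hi]
  exact Finset.sum_le_sum fun j _ => gap_term_mono hxy hy (hv j)

theorem State.gap_le_of_val_le {k : Fin n} (hx : x < s.val D k) (hk : s.val D k ≤ s.val D i) :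
    s.gap D i x ≤ s.gap D k x := by
  refine Finset.sum_le_sum fun j _ => ?_
  rcases le_total (s.val D j) (s.val D i) with h | h
  · rw [max_eq_right (sub_nonpos.2 h), zero_div]
    exact gap_term_nonneg hx
  · exact div_le_div_of_nonneg_right (max_le_max (by linarith) le_rfl) (by linarith)

theorem sum_gap_term {ι : Type*} (T : Finset ι) (w : ι → ℝ) (a x : ℝ) (hT : ∀ j ∈ T, x < w j) :
    ∑ j ∈ T, (w j - a) / (w j - x) = T.card - (a - x) * ∑ j ∈ T, 1 / (w j - x) := by
  rw [Finset.mul_sum, Finset.card_eq_sum_ones, Nat.cast_sum, ← Finset.sum_sub_distrib]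
  refine Finset.sum_congr rfl fun j hj => ?_
  have := sub_pos.2 (hT j hj)
  field_simp
  push_cast
  ring

theorem State.card_sub_one_mul_le_of_gap_le {T : Finset (Fin n)} (hT : ∀ j ∈ T, x < s.val D j)
    (hx : x < s.val D i) (hg : s.gap D i x ≤ 1) :
    ((T.card : ℝ) - 1) * (1 / (s.val D i - x)) ≤ ∑ j ∈ T, 1 / (s.val D j - x) := by
  have h1 : ∑ j ∈ T, (s.val D j - s.val D i) / (s.val D j - x) ≤ s.gap D i x :=
    (Finset.sum_le_sum fun j hj => div_le_div_of_nonneg_right (le_max_left _ _)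
      (sub_pos.2 (hT j hj)).le).trans
      (Finset.sum_le_univ_sum_of_nonneg fun j => gap_term_nonneg hx)
  rw [sum_gap_term T _ _ _ hT] at h1
  rw [mul_one_div, div_le_iff₀ (sub_pos.2 hx)]
  linarith

theorem one_lt_card (h : 2 ≤ s.bidders.card) : (0 : ℝ) < (s.bidders.card : ℝ) - 1 := by
  have : (2 : ℝ) ≤ s.bidders.card := by exact_mod_cast h
  linarith

theorem State.one_div_le_rate (h2 : 2 ≤ s.bidders.card) (hs : ∀ j ∈ s.bidders, x < s.val D j)
    (hx : x < s.val D i) (hg : s.gap D i x ≤ 1) : 1 / (s.val D i - x) ≤ s.rate D x := by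
  have := State.card_sub_one_mul_le_of_gap_le hs hx hg
  rw [State.rate, one_div_mul_eq_div, le_div_iff₀ (one_lt_card h2)]
  linarith

theorem State.entryCondition_of_gap_le (hs : ∀ j ∈ s.bidders, x < s.val D j)
    (hx : x < s.val D i) (hg : s.gap D i x ≤ 1) : s.EntryCondition D i x := by
  refine ⟨hx, ?_⟩
  rcases Nat.lt_or_ge 1 s.bidders.card with h | h
  · exact Or.inr (State.one_div_le_rate h hs hx hg)
  · exact Or.inl h

/-- If a bidder has no larger value, his gap bounds this one. Otherwise exactly the bidders exceed
`i`, the gap is `|Λ| - (v_i - x) ∑ 1 / (v_j - x)`, and the entry condition says that this is at most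
`1`. -/
theorem State.gap_le_of_entryCondition (hs : ∀ j ∈ s.bidders, x < s.val D j)
    (hg : ∀ j ∈ s.bidders, s.gap D j x ≤ 1) (hmax : ∀ k, k ∉ s.bidders → s.val D k ≤ s.val D i)
    (h : s.EntryCondition D i x) : s.gap D i x ≤ 1 := by
  obtain ⟨hx, h⟩ := h
  by_cases hk : ∃ k ∈ s.bidders, s.val D k ≤ s.val D i
  · obtain ⟨k, hk, hki⟩ := hk
    exact (State.gap_le_of_val_le (hs k hk) hki).trans (hg k hk)
  push Not at hk
  have hgap : s.gap D i x = ∑ j ∈ s.bidders, (s.val D j - s.val D i) / (s.val D j - x) := by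
    unfold State.gap
    rw [← Finset.sum_subset (Finset.subset_univ s.bidders)]
    · refine Finset.sum_congr rfl fun j hj => ?_
      rw [max_eq_left (by linarith [hk j hj])]
    · intro j _ hj
      rw [max_eq_right (by linarith [hmax j hj]), zero_div]
  rw [hgap, sum_gap_term _ _ _ _ hs]
  have hpos : 0 ≤ ∑ j ∈ s.bidders, 1 / (s.val D j - x) :=
    Finset.sum_nonneg fun j hj => one_div_nonneg.2 (sub_pos.2 (hs j hj)).le
  have hx' := sub_pos.2 hx
  rcases Nat.lt_or_ge 1 s.bidders.card with h1 | h1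
  · have h := h.resolve_left (by omega)
    rw [one_div_mul_eq_div, div_le_div_iff₀ hx' (one_lt_card h1)] at h
    linarith
  · have : (s.bidders.card : ℝ) ≤ 1 := by exact_mod_cast h1
    nlinarith [mul_nonneg hx'.le hpos]

/-- No buyer can be added. -/
def State.Full (D : ValueProfile n) (s : State n) : Prop := ∀ u, ¬ AddBuyer D s u

/-- The rule tests only a waiting buyer of largest value, but a larger value makes the condition
easier to meet. -/
theorem State.Full.not_entryCondition (h : s.Full D) (hi : i ∉ s.bidders) :
    ¬ s.EntryCondition D i s.b := by
  intro he
  obtain ⟨k, hk, hmax⟩ := Finset.exists_max_image s.biddersᶜ (s.val D)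
    ⟨i, Finset.mem_compl.2 hi⟩
  have hik := hmax i (Finset.mem_compl.2 hi)
  refine h _ ⟨k, Finset.mem_compl.1 hk, fun j hj => hmax j (Finset.mem_compl.2 hj),
    ⟨he.1.trans_le hik, he.2.imp_right fun h => le_trans ?_ h⟩, rfl⟩
  exact one_div_le_one_div_of_le (sub_pos.2 he.1) (by linarith)

theorem State.full_of_not_entryCondition (h : ∀ i, i ∉ s.bidders → ¬ s.EntryCondition D i s.b) :
    s.Full D := by
  rintro u ⟨i, hi, -, he, -⟩
  exact h i hi he

/-- The comparison of the averages of two states: lower values give a larger average. -/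
theorem State.rate_le_rate (hs2 : 2 ≤ s.bidders.card) (ht2 : 2 ≤ t.bidders.card)
    (hs : ∀ j ∈ s.bidders, x < s.val D j) (hg : ∀ j ∈ s.bidders, s.gap D j x ≤ 1)
    (hs' : ∀ j, j ∉ s.bidders → ¬ s.EntryCondition D j x)
    (ht : ∀ j ∈ t.bidders, x < t.val D j) (hv : ∀ j, t.val D j ≤ s.val D j) :
    s.rate D x ≤ t.rate D x := by
  set c := s.rate D x with hc
  have hcs : ∑ j ∈ s.bidders, 1 / (s.val D j - x) = ((s.bidders.card : ℝ) - 1) * c := by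
    rw [hc, State.rate, one_div_mul_eq_div, mul_div_cancel₀ _ (one_lt_card hs2).ne']
  -- The right side equals `c`. Among values above `x`, those of `s.bidders` give the terms `c - 1 /
  -- (v_j - x) ≥ 0` and all others negative terms, so `s.bidders` maximizes the sum over sets of
  -- such buyers.
  have hle : ∑ j ∈ t.bidders, (c - 1 / (t.val D j - x)) ≤
      ∑ j ∈ s.bidders, (c - 1 / (s.val D j - x)) := by
    calc ∑ j ∈ t.bidders, (c - 1 / (t.val D j - x))
        ≤ ∑ j ∈ t.bidders, (c - 1 / (s.val D j - x)) := by
          refine Finset.sum_le_sum fun j hj => sub_le_sub_left ?_ _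
          exact one_div_le_one_div_of_le (sub_pos.2 (ht j hj)) (by linarith [hv j])
      _ ≤ ∑ j ∈ t.bidders ∩ s.bidders, (c - 1 / (s.val D j - x)) := by
          rw [← Finset.sum_inter_add_sum_sdiff t.bidders s.bidders]
          refine add_le_of_nonpos_right (Finset.sum_nonpos fun j hj => ?_)
          rw [Finset.mem_sdiff] at hj
          have h := hs' j hj.2
          simp only [State.EntryCondition, not_and_or, not_or, not_le] at h
          have h := (h.resolve_left (not_not.2 ((ht j hj.1).trans_le (hv j)))).2
          exact sub_nonpos.2 h.le
      _ ≤ ∑ j ∈ s.bidders, (c - 1 / (s.val D j - x)) :=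
          Finset.sum_le_sum_of_subset_of_nonneg Finset.inter_subset_right fun j hj _ =>
            sub_nonneg.2 (State.one_div_le_rate hs2 hs (hs j hj) (hg j hj))
  rw [Finset.sum_sub_distrib, Finset.sum_sub_distrib, hcs] at hle
  simp only [Finset.sum_const, nsmul_eq_mul] at hle
  rw [State.rate, one_div_mul_eq_div, le_div_iff₀ (one_lt_card ht2)]
  linarith

/-! ### The invariant of the algorithm -/

/-- The strict bound `lt_F` says that no current value is used up. Together with `F_le` it makes `F
i` determine `idx i`. -/
structure State.Valid (D : ValueProfile n) (s : State n) : Prop where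
  b_nonneg : 0 ≤ s.b
  one_le_idx : ∀ i, 1 ≤ s.idx i
  idx_le : ∀ i, s.idx i ≤ D.d i
  lt_F : ∀ i, D.G i (s.idx i - 1) < s.F i
  F_le : ∀ i, s.F i ≤ D.G i (s.idx i)
  lt_val : ∀ i ∈ s.bidders, s.b < s.val D i
  gap_le : ∀ i ∈ s.bidders, s.gap D i s.b ≤ 1
  enter_isSome : ∀ i j, (s.enter i j).isSome ↔
    j ≤ D.d i ∧ (s.idx i < j ∨ j = s.idx i ∧ i ∈ s.bidders)
  leave_isSome : ∀ i j, (s.leave i j).isSome ↔ j ≤ D.d i ∧ s.idx i < j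
  le_enter : ∀ i j, ∀ a ∈ s.enter i j, s.b ≤ a
  le_leave : ∀ i j, ∀ a ∈ s.leave i j, s.b ≤ a

theorem initial_valid (D : ValueProfile n) {bbar : ℝ} (hb : 0 ≤ bbar) :
    (initial D bbar).Valid D where
  b_nonneg := hb
  one_le_idx := D.d_pos
  idx_le _ := le_rfl
  lt_F i := by
    have := D.G_pred_lt i (D.d_pos i) le_rfl
    rwa [D.G_d] at this
  F_le i := (D.G_d i).ge
  lt_val i hi := by simp [initial] at hi
  gap_le i hi := by simp [initial] at hi
  enter_isSome i j := by
    simp only [initial, Option.isSome_none, Finset.notMem_empty, and_false, or_false]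
    constructor
    · simp
    · omega
  leave_isSome i j := by
    simp only [initial, Option.isSome_none]
    constructor
    · simp
    · omega
  le_enter i j a h := by simp [initial] at h
  le_leave i j a h := by simp [initial] at h

theorem State.Valid.F_pos (h : s.Valid D) (i : Fin n) : 0 < s.F i := by
  refine lt_of_le_of_lt ?_ (h.lt_F i)
  rw [← D.G_zero i]
  exact D.G_mono i (Nat.zero_le _) (by have := h.idx_le i; omega)

theorem State.Valid.F_le_one (h : s.Valid D) (i : Fin n) : s.F i ≤ 1 :=
  (h.F_le i).trans ((D.G_mono i (h.idx_le i) le_rfl).trans (D.G_d i).le)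

theorem State.Valid.le_upper (h : s.Valid D) (i : Fin n) (j : ℕ) : s.b ≤ s.upper i j := by
  unfold State.upper
  cases he : s.enter i j with
  | none => exact le_rfl
  | some a => exact h.le_enter i j a he

theorem State.Valid.le_lower (h : s.Valid D) (i : Fin n) (j : ℕ) : s.b ≤ s.lower i j := by
  unfold State.lower
  cases he : s.leave i j with
  | none => exact le_rfl
  | some a => exact h.le_leave i j a he

/-! ### Adding buyers -/

theorem AddBuyer.valid (h : AddBuyer D s t) (hs : s.Valid D) : t.Valid D := by
  obtain ⟨i, hi, hmax, he, rfl⟩ := h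
  refine ⟨hs.b_nonneg, hs.one_le_idx, hs.idx_le, hs.lt_F, hs.F_le, fun k hk => ?_,
    fun k hk => ?_, fun k j => ?_, hs.leave_isSome, fun k j a ha => ?_, hs.le_leave⟩
  · rcases Finset.mem_insert.1 hk with rfl | hk
    · exact he.1
    · exact hs.lt_val k hk
  · rcases Finset.mem_insert.1 hk with rfl | hk
    · exact State.gap_le_of_entryCondition (s := s) hs.lt_val hs.gap_le hmax he
    · exact hs.gap_le k hk
  · have h1 := hs.enter_isSome k j
    have h2 := hs.idx_le k
    by_cases hk : k = i
    · subst hk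
      by_cases hj : j = s.idx k
      · subst hj
        simp [h2]
      · simp [hj, h1]
    · simp [hk, h1]
  · by_cases hk : k = i
    · subst hk
      by_cases hj : j = s.idx k
      · subst hj
        simp at ha
        exact ha.le
      · simp [hj] at ha
        exact hs.le_enter k j a ha
    · simp [hk] at ha
      exact hs.le_enter k j a ha

/-- The entry is recorded at the current bid, which was already the default for an undetermined
endpoint. -/
theorem AddBuyer.upper_eq (h : AddBuyer D s t) (hs : s.Valid D) : t.upper = s.upper := by
  obtain ⟨i, hi, hmax, he, rfl⟩ := h
  funext k j
  unfold State.upper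
  by_cases hk : k = i
  · subst hk
    by_cases hj : j = s.idx k
    · subst hj
      have h1 : s.enter k (s.idx k) = none := by
        rw [← Option.not_isSome_iff_eq_none, hs.enter_isSome]
        simp [hi]
      simp [h1]
    · simp [hj]
  · simp [hk]

theorem AddBuyers.induct {P : State n → Prop} (h : AddBuyers D s t) (hs : P s)
    (hstep : ∀ u v, AddBuyer D u v → P u → P v) : P t := by
  obtain ⟨h, -⟩ := h
  induction h with
  | refl => exact hs
  | tail _ h2 ih => exact hstep _ _ h2 ih

theorem AddBuyers.valid (h : AddBuyers D s t) (hs : s.Valid D) : t.Valid D :=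
  h.induct hs fun _ _ huv hu => huv.valid hu

theorem AddBuyers.upper_eq (h : AddBuyers D s t) (hs : s.Valid D) : t.upper = s.upper :=
  (h.induct (P := fun u => u.Valid D ∧ u.upper = s.upper) ⟨hs, rfl⟩ fun _ _ huv hu =>
    ⟨huv.valid hu.1, (huv.upper_eq hu.1).trans hu.2⟩).2

theorem AddBuyers.b_eq (h : AddBuyers D s t) : t.b = s.b := by
  refine h.induct (P := fun u => u.b = s.b) rfl ?_
  rintro u _ ⟨i, -, -, -, rfl⟩ hu
  exact hu

theorem AddBuyers.F_eq (h : AddBuyers D s t) : t.F = s.F := by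
  refine h.induct (P := fun u => u.F = s.F) rfl ?_
  rintro u _ ⟨i, -, -, -, rfl⟩ hu
  exact hu

theorem AddBuyers.lower_eq (h : AddBuyers D s t) : t.lower = s.lower := by
  refine h.induct (P := fun u => u.lower = s.lower) rfl ?_
  rintro u _ ⟨i, -, -, -, rfl⟩ hu
  exact hu

theorem AddBuyers.refl (h : s.Full D) : AddBuyers D s s := ⟨.refl, h⟩

/-! ### Moving the bid -/

/-- Nobody leaves or enters at a bid strictly between `x` and the current bid. -/
def State.Quiet (D : ValueProfile n) (s : State n) (x : ℝ) : Prop :=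
  ∀ y, x < y → y < s.b → (∀ i, ¬ s.Consumed D i y) ∧ ∀ i, i ∉ s.bidders → ¬ s.EntryCondition D i y

theorem State.IsNextBid.quiet (h : s.IsNextBid D x) : s.Quiet D x := by
  intro y hxy hyb
  have h0 : 0 ≤ y := h.1.1.trans hxy.le
  exact ⟨fun i hi => hxy.not_ge (h.2 ⟨h0, hyb, .inr (.inl ⟨i, hi⟩)⟩),
    fun i hi he => hxy.not_ge (h.2 ⟨h0, hyb, .inr (.inr ⟨i, hi, he⟩)⟩)⟩

theorem State.hasDerivAt_H (hs : ∀ j ∈ s.bidders, y < s.val D j) (hi : i ∈ s.bidders) :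
    HasDerivAt (s.H D i) (s.rate D y - 1 / (s.val D i - y)) y := by
  have hlog : ∀ j ∈ s.bidders,
      HasDerivAt (fun x => Real.log (s.val D j - x)) (-(1 / (s.val D j - y))) y := by
    intro j hj
    have h := ((hasDerivAt_id y).const_sub (s.val D j)).log (sub_pos.2 (hs j hj)).ne'
    simpa [neg_div] using h
  have h := (hlog i hi).sub ((HasDerivAt.fun_sum hlog).const_mul (1 / ((s.bidders.card : ℝ) - 1)))
  refine h.congr_deriv ?_
  rw [State.rate, Finset.sum_neg_distrib]
  ring

theorem State.Valid.hasDerivAt_H (h : s.Valid D) (hi : i ∈ s.bidders) (hy : y ≤ s.b) :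
    HasDerivAt (s.H D i) (s.rate D y - 1 / (s.val D i - y)) y :=
  State.hasDerivAt_H (fun j hj => hy.trans_lt (h.lt_val j hj)) hi

theorem State.Valid.gap_le_of_le (h : s.Valid D) (hi : i ∈ s.bidders) (hy : y ≤ s.b) :
    s.gap D i y ≤ 1 :=
  (State.gap_mono rfl (fun _ => le_rfl) hy (h.lt_val i hi)).trans (h.gap_le i hi)

theorem State.bidCdf_of_mem (hi : i ∈ s.bidders) (x : ℝ) :
    s.bidCdf D i x = s.F i * Real.exp (s.H D i x - s.H D i s.b) := if_pos hi

theorem State.bidCdf_of_notMem (hi : i ∉ s.bidders) (x : ℝ) : s.bidCdf D i x = s.F i := if_neg hi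

theorem State.bidCdf_b (i : Fin n) : s.bidCdf D i s.b = s.F i := by
  by_cases hi : i ∈ s.bidders
  · simp [State.bidCdf_of_mem hi]
  · exact State.bidCdf_of_notMem hi _

theorem State.Valid.continuousOn_bidCdf (h : s.Valid D) (i : Fin n) :
    ContinuousOn (s.bidCdf D i) (Set.Iic s.b) := by
  by_cases hi : i ∈ s.bidders
  · have hH : ContinuousOn (s.H D i) (Set.Iic s.b) := fun y hy =>
      (h.hasDerivAt_H hi hy).continuousAt.continuousWithinAt
    rw [funext (State.bidCdf_of_mem hi)]
    exact continuousOn_const.mul (hH.sub continuousOn_const).rexp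
  · rw [funext (State.bidCdf_of_notMem hi)]
    exact continuousOn_const

theorem le_of_forall_hasDerivAt_le {f g f' g' : ℝ → ℝ} {a b : ℝ} (hab : a ≤ b)
    (hf : ∀ y ∈ Set.Icc a b, HasDerivAt f (f' y) y) (hg : ∀ y ∈ Set.Icc a b, HasDerivAt g (g' y) y)
    (hle : ∀ y ∈ Set.Ioo a b, f' y ≤ g' y) : g a - g b ≤ f a - f b := by
  have hmono : MonotoneOn (g - f) (Set.Icc a b) := by
    refine monotoneOn_of_hasDerivWithinAt_nonneg (convex_Icc a b) (f' := g' - f')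
      (fun y hy => ((hg y hy).sub (hf y hy)).continuousAt.continuousWithinAt)
      (fun y hy => ?_) fun y hy => ?_
    · rw [interior_Icc] at hy
      have hy' := Set.Ioo_subset_Icc_self hy
      exact ((hg y hy').sub (hf y hy')).hasDerivWithinAt
    · rw [interior_Icc] at hy
      exact sub_nonneg.2 (hle y hy)
  have := hmono (Set.left_mem_Icc.2 hab) (Set.right_mem_Icc.2 hab) hab
  simp only [Pi.sub_apply] at this
  linarith

/-- A gap of at most `1` makes `(ln F_i)'` nonnegative, so `F_i` cannot grow as the bid falls. -/
theorem State.Valid.bidCdf_le (h : s.Valid D) (h2 : 2 ≤ s.bidders.card) (hx : x ≤ s.b) (i : Fin n) :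
    s.bidCdf D i x ≤ s.F i := by
  by_cases hi : i ∈ s.bidders
  · have := le_of_forall_hasDerivAt_le (f := fun _ => 0) (f' := fun _ => 0) hx
      (fun y _ => hasDerivAt_const y 0) (fun y hy => h.hasDerivAt_H hi hy.2) fun y hy =>
        sub_nonneg.2 (State.one_div_le_rate h2 (fun j hj => hy.2.trans (h.lt_val j hj))
          (hy.2.trans (h.lt_val i hi)) (h.gap_le_of_le hi hy.2.le))
    rw [State.bidCdf_of_mem hi]
    exact mul_le_of_le_one_right (h.F_pos i).le (Real.exp_le_one_iff.2 (by simpa using this))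
  · exact (State.bidCdf_of_notMem hi x).le

theorem State.Valid.le_bidCdf (h : s.Valid D) (hq : s.Quiet D x) (hx : x < s.b) (i : Fin n) :
    D.G i (s.idx i - 1) ≤ s.bidCdf D i x := by
  by_cases hi : i ∈ s.bidders
  · by_contra! hlt
    -- Falling below the level would cross it strictly above `x`, where nobody leaves.
    obtain ⟨y, hy, hyG⟩ := intermediate_value_Ioo hx.le
      ((h.continuousOn_bidCdf i).mono Set.Icc_subset_Iic_self)
      ⟨hlt, (h.lt_F i).trans_eq (State.bidCdf_b i).symm⟩
    exact (hq y hy.1 hy.2).1 i ⟨hi, hyG⟩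
  · rw [State.bidCdf_of_notMem hi]
    exact (h.lt_F i).le

/-- The lowest value is never consumed: its level is `G i 0 = 0`, while `F_i` stays positive. -/
theorem State.Valid.two_le_idx (h : s.Valid D) (hc : s.Consumed D i x) : 2 ≤ s.idx i := by
  by_contra! hlt
  have h1 : s.idx i - 1 = 0 := by omega
  have hc' := hc.2
  rw [h1, D.G_zero, State.bidCdf_of_mem hc.1] at hc'
  exact (mul_pos (h.F_pos i) (Real.exp_pos _)).ne' hc'

theorem State.moveTo_idx_of_consumed (hc : s.Consumed D i x) :
    (s.moveTo D x).idx i = s.idx i - 1 := if_pos hc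

theorem State.moveTo_idx_of_not_consumed (hc : ¬ s.Consumed D i x) :
    (s.moveTo D x).idx i = s.idx i := if_neg hc

theorem State.mem_moveTo_bidders :
    i ∈ (s.moveTo D x).bidders ↔ i ∈ s.bidders ∧ ¬ s.Consumed D i x := by
  simp [State.moveTo]

theorem State.Valid.moveTo_val_le (h : s.Valid D) (x : ℝ) (i : Fin n) :
    (s.moveTo D x).val D i ≤ s.val D i := by
  unfold State.val
  by_cases hc : s.Consumed D i x
  · rw [State.moveTo_idx_of_consumed hc]
    have := h.two_le_idx hc
    exact D.v_mono i (by omega) (by omega) (h.idx_le i)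
  · rw [State.moveTo_idx_of_not_consumed hc]

theorem State.moveTo_val_of_not_consumed (hc : ¬ s.Consumed D i x) :
    (s.moveTo D x).val D i = s.val D i := by
  rw [State.val, State.moveTo_idx_of_not_consumed hc, State.val]

theorem State.Valid.moveTo (h : s.Valid D) (h2 : 2 ≤ s.bidders.card) (h0 : 0 ≤ x) (hx : x < s.b)
    (hq : s.Quiet D x) : (s.moveTo D x).Valid D where
  b_nonneg := h0
  one_le_idx i := by
    by_cases hc : s.Consumed D i x
    · rw [State.moveTo_idx_of_consumed hc]
      have := h.two_le_idx hc
      omega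
    · rw [State.moveTo_idx_of_not_consumed hc]
      exact h.one_le_idx i
  idx_le i := by
    have := h.idx_le i
    by_cases hc : s.Consumed D i x
    · rw [State.moveTo_idx_of_consumed hc]
      omega
    · rwa [State.moveTo_idx_of_not_consumed hc]
  lt_F i := by
    change _ < s.bidCdf D i x
    by_cases hc : s.Consumed D i x
    · rw [State.moveTo_idx_of_consumed hc, hc.2]
      have h1 := h.two_le_idx hc
      have h2 := h.idx_le i
      exact D.G_pred_lt i (by omega) (by omega)
    · rw [State.moveTo_idx_of_not_consumed hc]
      by_cases hi : i ∈ s.bidders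
      · exact (h.le_bidCdf hq hx i).lt_of_ne fun he => hc ⟨hi, he.symm⟩
      · rw [State.bidCdf_of_notMem hi]
        exact h.lt_F i
  F_le i := by
    change s.bidCdf D i x ≤ _
    by_cases hc : s.Consumed D i x
    · rw [State.moveTo_idx_of_consumed hc, hc.2]
    · rw [State.moveTo_idx_of_not_consumed hc]
      exact (h.bidCdf_le h2 hx.le i).trans (h.F_le i)
  lt_val i hi := by
    rw [State.mem_moveTo_bidders] at hi
    rw [State.moveTo_val_of_not_consumed hi.2]
    exact hx.trans (h.lt_val i hi.1)
  gap_le i hi := by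
    rw [State.mem_moveTo_bidders] at hi
    exact (State.gap_mono (State.moveTo_val_of_not_consumed hi.2) (h.moveTo_val_le x) hx.le
      (h.lt_val i hi.1)).trans (h.gap_le i hi.1)
  enter_isSome i j := by
    have h1 := h.idx_le i
    refine (h.enter_isSome i j).trans ?_
    rw [State.mem_moveTo_bidders]
    by_cases hc : s.Consumed D i x
    · rw [State.moveTo_idx_of_consumed hc]
      have := h.two_le_idx hc
      have hi := hc.1
      simp only [hi, hc, not_true_eq_false, and_false, or_false, and_true]
      omega
    · rw [State.moveTo_idx_of_not_consumed hc]
      simp [hc]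
  leave_isSome i j := by
    have h1 := h.idx_le i
    have h3 := h.leave_isSome i j
    by_cases hc : s.Consumed D i x
    · rw [State.moveTo_idx_of_consumed hc]
      have := h.two_le_idx hc
      by_cases hj : j = s.idx i
      · simp [State.moveTo, hc, hj]
        omega
      · simp only [State.moveTo, hj, and_false, if_false, h3]
        omega
    · rw [State.moveTo_idx_of_not_consumed hc]
      simpa [State.moveTo, hc] using h3
  le_enter i j a ha := hx.le.trans (h.le_enter i j a ha)
  le_leave i j a ha := by
    change x ≤ a
    by_cases hj : s.Consumed D i x ∧ j = s.idx i
    · simp [State.moveTo, hj] at ha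
      exact ha.le
    · simp only [State.moveTo, hj, if_false] at ha
      exact hx.le.trans (h.le_leave i j a ha)

theorem State.Valid.moveTo_lower (h : s.Valid D) (x : ℝ) (i : Fin n) (j : ℕ) :
    (s.moveTo D x).lower i j = (s.leave i j).getD x := by
  by_cases hj : s.Consumed D i x ∧ j = s.idx i
  · have : s.leave i j = none := by
      rw [← Option.not_isSome_iff_eq_none, h.leave_isSome]
      omega
    simp [State.lower, State.moveTo, hj]
    simp [← hj.2, this]
  · simp [State.lower, State.moveTo, hj]

/-- A move to a bid above which nothing happens. -/
structure Move (D : ValueProfile n) (s : State n) (x : ℝ) (t : State n) : Prop where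
  two_le_card : 2 ≤ s.bidders.card
  nonneg : 0 ≤ x
  lt : x < s.b
  quiet : s.Quiet D x
  addBuyers : AddBuyers D (s.moveTo D x) t

theorem LoopStep.exists_move (h : LoopStep D s t) : ∃ x, s.IsNextBid D x ∧ Move D s x t := by
  obtain ⟨hr, x, hx, ha⟩ := h
  exact ⟨x, hx, hr.1, hx.1.1, hx.1.2.1, State.IsNextBid.quiet hx, ha⟩

theorem Move.valid_moveTo (h : Move D s x t) (hs : s.Valid D) : (s.moveTo D x).Valid D :=
  hs.moveTo h.two_le_card h.nonneg h.lt h.quiet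

theorem Move.valid (h : Move D s x t) (hs : s.Valid D) : t.Valid D :=
  h.addBuyers.valid (h.valid_moveTo hs)

theorem Move.b_eq (h : Move D s x t) : t.b = x := h.addBuyers.b_eq

theorem Move.F_eq (h : Move D s x t) (i : Fin n) : t.F i = s.bidCdf D i x :=
  congrFun h.addBuyers.F_eq i

theorem Move.upper_eq (h : Move D s x t) (hs : s.Valid D) (i : Fin n) (j : ℕ) :
    t.upper i j = (s.enter i j).getD x := by
  rw [h.addBuyers.upper_eq (h.valid_moveTo hs)]
  rfl

theorem Move.lower_eq (h : Move D s x t) (hs : s.Valid D) (i : Fin n) (j : ℕ) :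
    t.lower i j = (s.leave i j).getD x := by
  rw [h.addBuyers.lower_eq, hs.moveTo_lower]

theorem getD_mono {o : Option ℝ} (h : x ≤ y) : o.getD x ≤ o.getD y := by
  cases o
  · exact h
  · exact le_rfl

theorem Move.upper_le (h : Move D s x t) (hs : s.Valid D) (i : Fin n) (j : ℕ) :
    t.upper i j ≤ s.upper i j :=
  (h.upper_eq hs i j).trans_le (getD_mono h.lt.le)

theorem Move.lower_le (h : Move D s x t) (hs : s.Valid D) (i : Fin n) (j : ℕ) :
    t.lower i j ≤ s.lower i j :=
  (h.lower_eq hs i j).trans_le (getD_mono h.lt.le)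

/-! ### Interrupting a move -/

theorem State.Quiet.moveTo_eq (hq : s.Quiet D x) (hxy : x < y) (hy : y < s.b) :
    s.moveTo D y = { s with b := y, F := fun i => s.bidCdf D i y } := by
  have hc := (hq y hxy hy).1
  simp [State.moveTo, hc]

/-- The exponential factors from `b` to `y` and from `y` to `z` multiply to the one from `b` to `z`.
-/
theorem State.bidCdf_interrupt (s : State n) (y : ℝ) :
    State.bidCdf D { s with b := y, F := fun i => s.bidCdf D i y } = s.bidCdf D := by
  funext i z
  by_cases hi : i ∈ s.bidders
  · rw [State.bidCdf_of_mem (s := { s with b := y, F := fun i => s.bidCdf D i y }) hi,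
      State.bidCdf_of_mem hi]
    change s.bidCdf D i y * Real.exp (s.H D i z - s.H D i y) = _
    rw [State.bidCdf_of_mem hi, mul_assoc, ← Real.exp_add]
    congr 2
    ring
  · rw [State.bidCdf_of_notMem (s := { s with b := y, F := fun i => s.bidCdf D i y }) hi,
      State.bidCdf_of_notMem hi]
    exact State.bidCdf_of_notMem hi y

theorem State.consumed_interrupt (s : State n) (y : ℝ) :
    State.Consumed D { s with b := y, F := fun i => s.bidCdf D i y } = s.Consumed D := by
  funext i z
  unfold State.Consumed
  rw [State.bidCdf_interrupt]

theorem State.moveTo_interrupt (s : State n) (x y : ℝ) :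
    State.moveTo D { s with b := y, F := fun i => s.bidCdf D i y } x = s.moveTo D x := by
  unfold State.moveTo
  rw [State.consumed_interrupt, State.bidCdf_interrupt]

theorem Move.interrupt (h : Move D s x t) (hxy : x < y) (hy : y < s.b) :
    Move D s y (s.moveTo D y) := by
  refine ⟨h.two_le_card, h.nonneg.trans hxy.le, hy, fun z hz => h.quiet z (hxy.trans hz), .refl ?_⟩
  rw [h.quiet.moveTo_eq hxy hy]
  exact State.full_of_not_entryCondition (h.quiet y hxy hy).2

theorem LoopStep.interrupt (h : LoopStep D s t) (hx : s.IsNextBid D x)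
    (hxy : x < y) (hy : y < s.b) : LoopStep D (s.moveTo D y) t := by
  obtain ⟨hr, x', hx', ha⟩ := h
  obtain rfl := hx.unique hx'
  rw [hx.quiet.moveTo_eq hxy hy]
  refine ⟨⟨hr.1, hx.1.1.trans_lt hxy⟩, x, ⟨⟨hx.1.1, hxy, ?_⟩, fun z hz => hx.2 ⟨hz.1,
    hz.2.1.trans hy, ?_⟩⟩, ?_⟩
  · rw [State.consumed_interrupt]
    exact hx.1.2.2
  · have := hz.2.2
    rwa [State.consumed_interrupt] at this
  · rwa [State.moveTo_interrupt]

/-! ### Comparison of two runs -/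

/-- The states of two runs at the same bid, where the second run has consumed more. -/
structure Ahead (D : ValueProfile n) (s t : State n) : Prop where
  valid_left : s.Valid D
  valid_right : t.Valid D
  full_left : s.Full D
  full_right : t.Full D
  b_eq : t.b = s.b
  F_le : ∀ i, t.F i ≤ s.F i
  upper_le : ∀ i j, s.upper i j ≤ t.upper i j
  lower_le : ∀ i j, s.lower i j ≤ t.lower i j

theorem Ahead.idx_le (h : Ahead D s t) (i : Fin n) : t.idx i ≤ s.idx i := by
  by_contra! hlt
  have h1 := D.G_mono i (Nat.le_sub_one_of_lt hlt) (by have := h.valid_right.idx_le i; omega)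
  linarith [h.valid_left.F_le i, h.valid_right.lt_F i, h.F_le i]

theorem Ahead.val_le (h : Ahead D s t) (i : Fin n) : t.val D i ≤ s.val D i :=
  D.v_mono i (h.valid_right.one_le_idx i) (h.idx_le i) (h.valid_left.idx_le i)

theorem Ahead.mem_bidders (h : Ahead D s t) (hi : i ∈ s.bidders) (hidx : t.idx i = s.idx i) :
    i ∈ t.bidders := by
  by_contra hit
  have hval : t.val D i = s.val D i := by rw [State.val, hidx, State.val]
  have hlt := h.valid_left.lt_val i hi
  refine h.full_right.not_entryCondition hit
    (State.entryCondition_of_gap_le h.valid_right.lt_val (by rwa [hval, h.b_eq]) ?_)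
  exact (State.gap_mono hval h.val_le h.b_eq.le hlt).trans (h.valid_left.gap_le i hi)

theorem Ahead.enter_isSome (h : Ahead D s t) {i : Fin n} {j : ℕ} (hs : (s.enter i j).isSome) :
    (t.enter i j).isSome := by
  rw [h.valid_left.enter_isSome] at hs
  rw [h.valid_right.enter_isSome]
  refine ⟨hs.1, ?_⟩
  have hidx := h.idx_le i
  rcases hs.2 with hlt | ⟨rfl, hi⟩
  · exact .inl (by omega)
  · rcases hidx.lt_or_eq with hlt | heq
    · exact .inl hlt
    · exact .inr ⟨heq.symm, h.mem_bidders hi heq⟩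

theorem Ahead.leave_isSome (h : Ahead D s t) {i : Fin n} {j : ℕ} (hs : (s.leave i j).isSome) :
    (t.leave i j).isSome := by
  rw [h.valid_left.leave_isSome] at hs
  rw [h.valid_right.leave_isSome]
  exact ⟨hs.1, (h.idx_le i).trans_lt hs.2⟩

/-- With a smaller index in `t`, the level `G i (s.idx i - 1)` separates the two sides. With equal
indices, a bidder of `s` also bids in `t` with a larger logarithmic derivative; a waiting buyer of
`s` keeps his `F`, while that of `t` can only fall. -/
theorem Ahead.bidCdf_le (h : Ahead D s t) {s' t' : State n} (hs : Move D s x s')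
    (ht : Move D t x t') (i : Fin n) : t.bidCdf D i x ≤ s.bidCdf D i x := by
  have hF := h.valid_right.bidCdf_le ht.two_le_card ht.lt.le i
  rcases (h.idx_le i).lt_or_eq with hlt | heq
  · have h1 := h.valid_left.idx_le i
    have h2 := D.G_mono i (Nat.le_sub_one_of_lt hlt) (by omega)
    linarith [h.valid_right.F_le i, h.valid_left.le_bidCdf hs.quiet hs.lt i]
  · by_cases hi : i ∈ s.bidders
    · have hit := h.mem_bidders hi heq
      have hval : t.val D i = s.val D i := by rw [State.val, heq, State.val]
      rw [State.bidCdf_of_mem hi, State.bidCdf_of_mem hit, h.b_eq]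
      refine mul_le_mul (h.F_le i) (Real.exp_le_exp.2 ?_) (Real.exp_pos _).le
        (h.valid_left.F_pos i).le
      refine le_of_forall_hasDerivAt_le hs.lt.le (fun y hy => h.valid_left.hasDerivAt_H hi hy.2)
        (fun y hy => h.valid_right.hasDerivAt_H hit (hy.2.trans_eq h.b_eq.symm)) fun y hy => ?_
      rw [hval]
      refine sub_le_sub_right (State.rate_le_rate hs.two_le_card ht.two_le_card
        (fun j hj => hy.2.trans (h.valid_left.lt_val j hj))
        (fun j hj => h.valid_left.gap_le_of_le hj hy.2.le) (hs.quiet y hy.1 hy.2).2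
        (fun j hj => ?_) h.val_le) _
      exact (hy.2.trans_eq h.b_eq.symm).trans (h.valid_right.lt_val j hj)
    · rw [State.bidCdf_of_notMem hi]
      exact hF.trans (h.F_le i)

theorem getD_le_getD {o p : Option ℝ} {b : ℝ} (hop : o.isSome → p.isSome)
    (hle : o.getD b ≤ p.getD b) (hp : ∀ a ∈ p, b ≤ a) (hx : x < b) : o.getD x ≤ p.getD x := by
  cases o with
  | none =>
    cases p with
    | none => exact le_rfl
    | some a => exact hx.le.trans (hp a rfl)
  | some a =>
    obtain ⟨c, rfl⟩ := Option.isSome_iff_exists.1 (hop rfl)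
    exact hle

theorem Ahead.move (h : Ahead D s t) {s' t' : State n} (hs : Move D s x s') (ht : Move D t x t') :
    Ahead D s' t' where
  valid_left := hs.valid h.valid_left
  valid_right := ht.valid h.valid_right
  full_left := hs.addBuyers.2
  full_right := ht.addBuyers.2
  b_eq := ht.b_eq.trans hs.b_eq.symm
  F_le i := by
    rw [hs.F_eq, ht.F_eq]
    exact h.bidCdf_le hs ht i
  upper_le i j := by
    have := h.upper_le i j
    rw [State.upper, State.upper, h.b_eq] at this
    rw [hs.upper_eq h.valid_left, ht.upper_eq h.valid_right]
    exact getD_le_getD h.enter_isSome this (h.b_eq ▸ h.valid_right.le_enter i j) hs.lt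
  lower_le i j := by
    have := h.lower_le i j
    rw [State.lower, State.lower, h.b_eq] at this
    rw [hs.lower_eq h.valid_left, ht.lower_eq h.valid_right]
    exact getD_le_getD h.leave_isSome this (h.b_eq ▸ h.valid_right.le_leave i j) hs.lt

/-- With at most one bidder in `s`, any waiting buyer with a value above the bid could enter;
fullness then puts every bidder of `t` into `s.bidders`. -/
theorem Ahead.running (h : Ahead D s t) (ht : t.Running) : s.Running := by
  refine ⟨?_, h.b_eq ▸ ht.2⟩
  by_contra! hlt
  have hsub : t.bidders ⊆ s.bidders := fun i hi => by
    by_contra his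
    refine h.full_left.not_entryCondition his ⟨?_, .inl (by omega)⟩
    exact (h.b_eq ▸ h.valid_right.lt_val i hi).trans_le (h.val_le i)
  have := Finset.card_le_card hsub
  have := ht.1
  omega

/-! ### Comparing complete runs -/

theorem LoopStep.valid (h : LoopStep D s t) (hs : s.Valid D) : t.Valid D := by
  obtain ⟨x, -, hx⟩ := h.exists_move
  exact hx.valid hs

theorem LoopStep.endpoints_le (h : LoopStep D s t) (hs : s.Valid D) (i : Fin n) (j : ℕ) :
    t.lower i j ≤ s.lower i j ∧ t.upper i j ≤ s.upper i j := by
  obtain ⟨x, -, hx⟩ := h.exists_move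
  exact ⟨hx.lower_le hs i j, hx.upper_le hs i j⟩

theorem endpoints_le_of_run (h : Relation.ReflTransGen (LoopStep D) s t) (hs : s.Valid D)
    (i : Fin n) (j : ℕ) : t.lower i j ≤ s.lower i j ∧ t.upper i j ≤ s.upper i j := by
  induction h using Relation.ReflTransGen.head_induction_on with
  | refl => exact ⟨le_rfl, le_rfl⟩
  | head hst _ ih =>
    have h1 := hst.endpoints_le hs i j
    have h2 := ih (hst.valid hs)
    exact ⟨h2.1.trans h1.1, h2.2.trans h1.2⟩

theorem eq_of_run_of_not_running (h : Relation.ReflTransGen (LoopStep D) s t)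
    (hs : ¬ s.Running) : t = s := by
  rcases h.cases_head with rfl | ⟨u, hu, -⟩
  · rfl
  · exact (hs hu.1).elim

theorem Ahead.endpoints_le {f g : State n} (hs : Relation.ReflTransGen (LoopStep D) s f)
    (ht : Relation.ReflTransGen (LoopStep D) t g) (hf : ¬ f.Running)
    (h : Ahead D s t) (i : Fin n) (j : ℕ) :
    f.lower i j ≤ g.lower i j ∧ f.upper i j ≤ g.upper i j := by
  induction hs using Relation.ReflTransGen.head_induction_on generalizing t with
  | refl =>
    rw [eq_of_run_of_not_running ht fun hr => hf (h.running hr)]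
    exact ⟨h.lower_le i j, h.upper_le i j⟩
  | @head s s' hss' hs'f ih =>
    -- The run whose next change is at the higher bid advances; the other is interrupted there and
    -- keeps its target.
    induction ht using Relation.ReflTransGen.head_induction_on generalizing s with
    | refl =>
      have h1 := endpoints_le_of_run (hs'f.head hss') h.valid_left i j
      exact ⟨h1.1.trans (h.lower_le i j), h1.2.trans (h.upper_le i j)⟩
    | @head t t' htt' ht'g ih' =>
      obtain ⟨x, hx, hsx⟩ := hss'.exists_move
      obtain ⟨y, hy, hty⟩ := htt'.exists_move
      rcases lt_trichotomy x y with hxy | rfl | hxy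
      · have hys : y < s.b := h.b_eq ▸ hty.lt
        exact ih' (hss'.interrupt hx hxy hys) (h.move (hsx.interrupt hxy hys) hty)
      · exact ih ht'g (h.move hsx hty)
      · have hxt : x < t.b := h.b_eq.symm ▸ hsx.lt
        exact ih (ht'g.head (htt'.interrupt hy hxy hxt)) (h.move hsx (hty.interrupt hxy hxt))

theorem endpoints_le_of_b_le {f g : State n} (hs : Relation.ReflTransGen (LoopStep D) s f)
    (ht : Relation.ReflTransGen (LoopStep D) t g) (hf : ¬ f.Running)
    (hsv : s.Valid D) (htv : t.Valid D) (hsf : s.Full D) (htf : t.Full D) (hb : s.b ≤ t.b)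
    (hF : ∀ i, s.F i = 1) (hu : ∀ i j, s.upper i j = s.b) (hl : ∀ i j, s.lower i j = s.b)
    (i : Fin n) (j : ℕ) : f.lower i j ≤ g.lower i j ∧ f.upper i j ≤ g.upper i j := by
  -- At the starting bid of `s` the order is automatic: `F` is `1` in `s`, and all endpoints of `s`
  -- equal the current bid.
  have key : ∀ u : State n, u.Valid D → u.Full D → u.b = s.b → Ahead D s u := fun u huv huf hub =>
    ⟨hsv, huv, hsf, huf, hub, fun i => (huv.F_le_one i).trans_eq (hF i).symm,
      fun i j => (hu i j).trans_le (hub ▸ huv.le_upper i j),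
      fun i j => (hl i j).trans_le (hub ▸ huv.le_lower i j)⟩
  induction ht using Relation.ReflTransGen.head_induction_on with
  | refl =>
    have h1 := endpoints_le_of_run hs hsv i j
    rw [hu, hl] at h1
    exact ⟨h1.1.trans (hb.trans (htv.le_lower i j)), h1.2.trans (hb.trans (htv.le_upper i j))⟩
  | @head t t' htt' ht'g ih =>
    rcases hb.lt_or_eq with hb | hb
    · obtain ⟨y, hy, hty⟩ := htt'.exists_move
      rcases le_or_gt s.b y with hsy | hsy
      · exact ih (hty.valid htv) hty.addBuyers.2 (hsy.trans_eq hty.b_eq.symm)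
      · have hm := hty.interrupt hsy hb
        exact (key _ (hm.valid htv) hm.addBuyers.2 rfl).endpoints_le hs
          (ht'g.head (htt'.interrupt hy hsy hb)) hf i j
    · exact (key t htv htf hb.symm).endpoints_le hs (ht'g.head htt') hf i j

/-! ### Termination -/

open Classical in
/-- A quantity that decreases whenever a buyer enters or leaves. -/
noncomputable def State.potential (s : State n) : ℕ :=
  ∑ i, (2 * s.idx i + if i ∈ s.bidders then 0 else 1)

theorem AddBuyer.potential_lt (h : AddBuyer D s t) : t.potential < s.potential := by
  obtain ⟨i, hi, -, -, rfl⟩ := h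
  refine Finset.sum_lt_sum (fun k _ => ?_) ⟨i, Finset.mem_univ i, ?_⟩
  · simp only [Finset.mem_insert]
    split_ifs <;> simp_all
  · simp [hi]

theorem AddBuyers.potential_le (h : AddBuyers D s t) : t.potential ≤ s.potential :=
  h.induct (P := fun u => u.potential ≤ s.potential) le_rfl fun _ _ huv hu =>
    huv.potential_lt.le.trans hu

theorem State.Valid.potential_moveTo_le (h : s.Valid D) (x : ℝ) :
    (s.moveTo D x).potential ≤ s.potential := by
  refine Finset.sum_le_sum fun i _ => ?_
  by_cases hc : s.Consumed D i x
  · rw [State.moveTo_idx_of_consumed hc]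
    have := h.two_le_idx hc
    split_ifs <;> omega
  · rw [State.moveTo_idx_of_not_consumed hc]
    simp [State.mem_moveTo_bidders, hc]

/-- A departure loses `2` through the index and regains `1` on the waiting list. -/
theorem State.Valid.potential_moveTo_lt (h : s.Valid D) (hi : s.Consumed D i x) :
    (s.moveTo D x).potential < s.potential := by
  refine Finset.sum_lt_sum (fun k _ => ?_) ⟨i, Finset.mem_univ i, ?_⟩
  · by_cases hc : s.Consumed D k x
    · rw [State.moveTo_idx_of_consumed hc]
      have := h.two_le_idx hc
      split_ifs <;> omega
    · rw [State.moveTo_idx_of_not_consumed hc]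
      simp [State.mem_moveTo_bidders, hc]
  · rw [State.moveTo_idx_of_consumed hi]
    have := h.two_le_idx hi
    split_ifs <;> omega

theorem exists_addBuyers (D : ValueProfile n) (s : State n) : ∃ t, AddBuyers D s t := by
  induction hk : s.potential using Nat.strong_induction_on generalizing s with
  | _ k ih =>
    by_cases h : s.Full D
    · exact ⟨s, .refl h⟩
    · simp only [State.Full, not_forall, not_not] at h
      obtain ⟨u, hu⟩ := h
      obtain ⟨t, ht⟩ := ih _ (hk ▸ hu.potential_lt) u rfl
      exact ⟨t, ht.1.head hu, ht.2⟩

theorem State.Valid.continuousOn_rate (h : s.Valid D) :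
    ContinuousOn (s.rate D) (Set.Iic s.b) := by
  refine continuousOn_const.mul (continuousOn_finsetSum _ fun j hj => ?_)
  exact continuousOn_const.div (continuousOn_const.sub continuousOn_id) fun y hy =>
    (sub_pos.2 (lt_of_le_of_lt hy (h.lt_val j hj))).ne'

/-- The product form absorbs the strict inequality `x < v_i`, so the condition becomes closed in
`x`. -/
theorem State.Valid.entryCondition_iff (h : s.Valid D) (h2 : 2 ≤ s.bidders.card) (hx : x ≤ s.b) :
    s.EntryCondition D i x ↔ 1 ≤ (s.val D i - x) * s.rate D x := by
  have hrate : 0 < s.rate D x := by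
    refine mul_pos (one_div_pos.2 (one_lt_card h2)) (Finset.sum_pos (fun j hj => ?_) ?_)
    · exact one_div_pos.2 (sub_pos.2 (hx.trans_lt (h.lt_val j hj)))
    · exact Finset.card_pos.1 (by omega)
  constructor
  · rintro ⟨hv, he⟩
    rw [← div_le_iff₀' (sub_pos.2 hv)]
    exact he.resolve_left (by omega)
  · intro he
    have hv : 0 < s.val D i - x := pos_of_mul_pos_left (one_pos.trans_le he) hrate.le
    exact ⟨sub_pos.1 hv, .inr ((div_le_iff₀' hv).2 he)⟩

theorem State.Valid.exists_isNextBid (h : s.Valid D) (hf : s.Full D) (hr : s.Running) :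
    ∃ x, s.IsNextBid D x := by
  have hsub : Set.Icc 0 s.b ⊆ Set.Iic s.b := Set.Icc_subset_Iic_self
  let A (i : Fin n) : Set ℝ := {y | y ∈ Set.Icc 0 s.b ∧ s.Consumed D i y}
  let B (i : Fin n) : Set ℝ := {y | y ∈ Set.Icc 0 s.b ∧ i ∉ s.bidders ∧ s.EntryCondition D i y}
  have hA : ∀ i, IsClosed (A i) := fun i => by
    by_cases hi : i ∈ s.bidders
    · have := ((h.continuousOn_bidCdf i).mono hsub).preimage_isClosed_of_isClosed isClosed_Icc
        (isClosed_singleton (x := D.G i (s.idx i - 1)))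
      convert this using 1
      ext y
      simp [A, State.Consumed, hi]
    · convert isClosed_empty using 1
      ext y
      simp [A, State.Consumed, hi]
  have hB : ∀ i, IsClosed (B i) := fun i => by
    by_cases hi : i ∈ s.bidders
    · convert isClosed_empty using 1
      ext y
      simp [B, hi]
    · have := (((continuousOn_const (c := s.val D i)).sub continuousOn_id).mul
        (h.continuousOn_rate.mono hsub)).preimage_isClosed_of_isClosed isClosed_Icc
        (isClosed_Ici (a := (1 : ℝ)))
      convert this using 1
      ext y
      refine and_congr_right fun hy => ?_
      rw [h.entryCondition_iff hr.1 hy.2]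
      simp [hi]
  have hK : IsCompact (({0} ∪ ⋃ i, A i) ∪ ⋃ i, B i) := by
    refine isCompact_Icc.of_isClosed_subset ((isClosed_singleton.union
      (isClosed_iUnion_of_finite hA)).union (isClosed_iUnion_of_finite hB)) (s := Set.Icc 0 s.b) ?_
    refine Set.union_subset (Set.union_subset ?_ ?_) ?_
    · exact Set.singleton_subset_iff.2 ⟨le_rfl, h.b_nonneg⟩
    · exact Set.iUnion_subset fun i y hy => hy.1
    · exact Set.iUnion_subset fun i y hy => hy.1
  obtain ⟨x, hx⟩ := hK.exists_isGreatest ⟨0, by simp⟩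
  refine ⟨x, ?_⟩
  refine (congrArg (IsGreatest · x) (Set.ext fun y => ?_)).mpr hx
  simp only [Set.mem_ofPred_eq, Set.mem_union, Set.mem_singleton_iff, Set.mem_iUnion, A, B]
  constructor
  · rintro ⟨h0, hb, rfl | ⟨i, hi⟩ | ⟨i, hi⟩⟩
    · exact .inl (.inl rfl)
    · exact .inl (.inr ⟨i, ⟨h0, hb.le⟩, hi⟩)
    · exact .inr ⟨i, ⟨h0, hb.le⟩, hi⟩
  · rintro ((rfl | ⟨i, hy, hi⟩) | ⟨i, hy, hi⟩)
    · exact ⟨le_rfl, hr.2, .inl rfl⟩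
    -- The current bid itself is excluded, here by the strict bound `lt_F` and in the next case by
    -- fullness.
    · refine ⟨hy.1, hy.2.lt_of_ne ?_, .inr (.inl ⟨i, hi⟩)⟩
      rintro rfl
      exact (h.lt_F i).ne' ((State.bidCdf_b i).symm.trans hi.2)
    · refine ⟨hy.1, hy.2.lt_of_ne ?_, .inr (.inr ⟨i, hi⟩)⟩
      rintro rfl
      exact hf.not_entryCondition hi.1 hi.2

theorem AddBuyers.potential_lt (h : AddBuyers D s t) (hi : i ∉ s.bidders)
    (he : s.EntryCondition D i s.b) : t.potential < s.potential := by
  rcases h.1.cases_head with rfl | ⟨u, hu, hut⟩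
  · exact (State.Full.not_entryCondition h.2 hi he).elim
  · exact (AddBuyers.potential_le ⟨hut, h.2⟩).trans_lt hu.potential_lt

/-- A step to the bid `0` may change no buyer, but then the loop stops; hence the assumption on `t`.
-/
theorem LoopStep.potential_lt (h : LoopStep D s t) (hs : s.Valid D) (ht : t.Running) :
    t.potential < s.potential := by
  obtain ⟨-, x, hx, ha⟩ := h
  have hle := ha.potential_le
  by_cases hc : ∃ i, s.Consumed D i x
  · obtain ⟨i, hi⟩ := hc
    exact hle.trans_lt (hs.potential_moveTo_lt hi)
  push Not at hc
  have hm := hs.potential_moveTo_le x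
  rcases hx.1.2.2 with rfl | ⟨i, hi⟩ | ⟨i, hi, he⟩
  · exact (ht.2.ne' ha.b_eq).elim
  · exact (hc i hi).elim
  · refine (ha.potential_lt (i := i) ?_ ?_).trans_le hm
    · exact fun hi' => hi (State.mem_moveTo_bidders.1 hi').1
    · have hb : (s.moveTo D x).bidders = s.bidders := by simp [State.moveTo, hc]
      have hv : (s.moveTo D x).val D = s.val D :=
        funext fun k => State.moveTo_val_of_not_consumed (hc k)
      unfold State.EntryCondition
      rw [hb, hv]
      exact he

theorem exists_run (h : s.Valid D) (hf : s.Full D) :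
    ∃ t, Relation.ReflTransGen (LoopStep D) s t ∧ ¬ t.Running := by
  induction hk : s.potential using Nat.strong_induction_on generalizing s with
  | _ k ih =>
    by_cases hr : s.Running
    · obtain ⟨x, hx⟩ := h.exists_isNextBid hf hr
      obtain ⟨u, hu⟩ := exists_addBuyers D (s.moveTo D x)
      have hsu : LoopStep D s u := ⟨hr, x, hx, hu⟩
      by_cases hur : u.Running
      · obtain ⟨t, ht, htr⟩ := ih _ (hk ▸ hsu.potential_lt h hur) (hsu.valid h) hu.2 rfl
        exact ⟨t, ht.head hsu, htr⟩
      · exact ⟨u, .single hsu, hur⟩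
    · exact ⟨s, .refl, hr⟩

end FirstPrice

theorem mainTheorem8 {n : ℕ} (D : FirstPrice.ValueProfile n) :
    (∀ bbar : ℝ, 0 ≤ bbar → ∃ s, FirstPrice.IsOutput D bbar s) ∧
    ∀ (bbar₁ bbar₂ : ℝ) (s₁ s₂ : FirstPrice.State n),
      0 ≤ bbar₁ → bbar₁ ≤ bbar₂ →
      FirstPrice.IsOutput D bbar₁ s₁ → FirstPrice.IsOutput D bbar₂ s₂ →
      ∀ (i : Fin n) (j : ℕ), 1 ≤ j → j ≤ D.d i →
        s₁.lower i j ≤ s₂.lower i j ∧ s₁.upper i j ≤ s₂.upper i j := by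
  constructor
  · intro bbar hb
    obtain ⟨s₀, hs₀⟩ := FirstPrice.exists_addBuyers D (FirstPrice.initial D bbar)
    obtain ⟨s, hs, hr⟩ := FirstPrice.exists_run
      (hs₀.valid (FirstPrice.initial_valid D hb)) hs₀.2
    exact ⟨s, s₀, hs₀, hs, hr⟩
  · rintro b₁ b₂ s₁ s₂ h₀ hb ⟨t₁, ht₁, hs₁, hr₁⟩ ⟨t₂, ht₂, hs₂, -⟩ i j - -
    have hv₁ := FirstPrice.initial_valid D h₀
    refine FirstPrice.endpoints_le_of_b_le hs₁ hs₂ hr₁ (ht₁.valid hv₁)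
      (ht₂.valid (FirstPrice.initial_valid D (h₀.trans hb))) ht₁.2 ht₂.2 ?_ ?_ ?_ ?_ i j
    · rw [ht₁.b_eq, ht₂.b_eq]
      exact hb
    · intro i
      rw [ht₁.F_eq]
      rfl
    · intro i j
      rw [ht₁.upper_eq hv₁, ht₁.b_eq]
      rfl
    · intro i j
      rw [ht₁.lower_eq, ht₁.b_eq]
      rfl
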